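/- **Setting.** A circular robot of radius $R>0$ moves in the plane among obstacle points $\mathcal O\subset\mathbb R^2$; the collision-free region is $M_{\rm free}=\{x:\ \|x-o\|_2\ge R\ \text{for all } o\in\mathcal O\}$, and $\varepsilon>0$ is a fixed raycasting tolerance. The length of a path $\gamma$ (total variation) is $g(\gamma)$. *Corridors.* A gap seen from a point $p$ is given by a short ray in the unit direction $u$, which first hits an obstacle at $p+\Phi_{\rm near}u$, and a long ray in the unit direction $a$, which first hits an obstacle at $p+\Phi_{\rm far}a$, with $\Phi_{\rm near}<\Phi_{\rm far}$ and $\langle u,a\rangle>0$, such that these two endpoints are at distance at least $2R$ and $\Phi_{\rm near}^2-\langle \Phi_{\rm near}u,a\rangle^2<\varepsilon^2$. Let $b$ be the unit vector orthogonal to $a$ with $\langle u,b\rangle<0$. The corridor is $D=M_{\rm free}\cap\{p+\phi a+\psi b:\ 0\le\phi\le\Phi_{\rm near},\ |\psi|\le R\}$, the critical point is $c=p+\Phi_{\rm near}a+Rb$, the edge $\alpha$ is a path of minimal (finite) length from $p$ to $c$ within $D$ (only gaps for which such a path exists are used), and the gap sweeper $\Delta$ is the set of the points $p+\phi a+Rb$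 with $\Phi_{\rm near}\le\phi\le\Phi_{\rm far}$ such that the whole segment from $c$ to this point lies in $M_{\rm free}$. *Topological tree.* The root is $p_{start}$. From each source point $p^i$ of the tree (the root, or a critical point constructed earlier) corridors with critical points $c_k^i$, edges $\alpha_k^i$ and gap sweepers $\Delta_k^i$ are constructed as above. The tree path of a source point or critical point is the concatenation of the edges leading to it from $p_{start}$; $g(p^i)$ and $g(c_k^i)$ denote its length. *Distinguished homotopies.* For a point $m$, the set $\varphi^{-1}([\cdot])$ of paths from $p_{start}$ to $m$ is defined along the tree. For the root it consists of all paths in $M_{\rm free}$ from $p_{start}$ to $m$. For a critical point $c=c_k^i$ it consists of all paths in $M_{\rm free}$ from $p_{start}$ to $m$ that visit $c$ so that the part up to this visit is homotopic in $M_{\rm free}$, with fixed endpoints, to the tree path of $c$, and belongs itself to the distinguished homotopy $[p^i]$ (with endpoint $c$). We write $\min_{\varphi^{-1}([\cdot])}g(m)$ for the minimal length of a path to $m$ in the respective set. **Lemma and Corollary (Comparison between Gap Sweeper and Edge).** Let $p^i,p^j$ be source points of the tree, with corridors $k$ and $l$ constructed from $p^i$ and $p^j$ respectively. Suppose the gap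 sweeper $\Delta_l^j$ and the edge $\alpha_k^i$ meet at $q$, and let $g(q)|_{{\rm from}\ p^i}$ be the length of $\alpha_k^i$ from $p^i$ to $q$. 1. If $g(p^i)+g(q)|_{{\rm from}\ p^i}>g(c_l^j)+\|c_l^j-q\|_2$, then for every $m\in\Delta_k^i$ both minima below exist and $$\min_{\varphi^{-1}([c_l^j])}g(m)<\min_{\varphi^{-1}([c_k^i])}g(m).$$ 2. If $g(c_l^j)>g(p^i)+g(q)|_{{\rm from}\ p^i}+\|q-c_l^j\|_2$, then for every $m\in\Delta_l^j$ both minima below exist and $$\min_{\varphi^{-1}([p^i])}g(m)<\min_{\varphi^{-1}([c_l^j])}g(m).$$ -/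

import Mathlib

open scoped ENNReal unitInterval

noncomputable section

/-- The planar workspace with its Euclidean metric. -/
abbrev Plane : Type := EuclideanSpace ℝ (Fin 2)

/-- Length of a path (total variation, possibly infinite). -/
def pathLength {x y : Plane} (γ : Path x y) : ℝ≥0∞ := eVariationOn γ Set.univ

/-- Length of the part of a path that is traversed up to the parameter `t`. -/
def pathLengthUpTo {x y : Plane} (γ : Path x y) (t : I) : ℝ≥0∞ := eVariationOn γ (Set.Iic t)

/-- Homotopy with fixed endpoints inside the region `M`. -/
def HomotopicIn (M : Set Plane) {x y : Plane} (γ δ : Path x y) : Prop :=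
  ∃ F : Path.Homotopy γ δ, ∀ z, F z ∈ M

/-- A planar environment, given by the set of its obstacle points, together with the radius `R`
of the circular robot and the tolerance `ε` of the raycasting. -/
structure Environment where
  obstacles : Set Plane
  R : ℝ
  R_pos : 0 < R
  ε : ℝ
  ε_pos : 0 < ε

namespace Environment

/-- The collision-free part `M_free`: the positions of the centre of the robot at which its
footprint, an open disc of radius `R`, contains no obstacle point. -/
def free (E : Environment) : Set Plane := {x | ∀ o ∈ E.obstacles, E.R ≤ dist x o}

/-- The ray from `p` with unit direction `u` has length `Φ`: it first hits an obstacle at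
`p + Φ u`. -/
def RayHits (E : Environment) (p u : Plane) (Φ : ℝ) : Prop :=
  ‖u‖ = 1 ∧ 0 ≤ Φ ∧ p + Φ • u ∈ E.obstacles ∧ ∀ t, 0 ≤ t → t < Φ → p + t • u ∉ E.obstacles

/-- A gap seen from `p`: a short ray (direction `u`, length `near`) next to a long ray
(direction `a`, length `far`).  The unit vector `b` is orthogonal to `a` and points to the side of
the long ray that does not contain the short ray (so that the two mirror-symmetric cases are
treated at once).  The endpoints of the two rays are at least `2R` apart, and the endpoint of the
short ray is `ε`-near to the long ray. -/
structure Gap (E : Environment) (p : Plane) where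
  a : Plane
  b : Plane
  u : Plane
  near : ℝ
  far : ℝ
  norm_b : ‖b‖ = 1
  inner_ab : inner ℝ a b = 0
  inner_ua : 0 < inner ℝ u a
  inner_ub : inner ℝ u b < 0
  near_ray : E.RayHits p u near
  far_ray : E.RayHits p a far
  near_lt_far : near < far
  separated : 2 * E.R ≤ dist (p + near • u) (p + far • a)
  close : near ^ 2 - (inner ℝ (near • u) a) ^ 2 < E.ε ^ 2

namespace Gap

variable {E : Environment} {p : Plane}

/-- The corridor `D`: the collision-free part of the rectangle of length `near` and half-width `R`
along the long ray. -/
def corridor (G : E.Gap p) : Set Plane :=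
  {x | x ∈ E.free ∧ ∃ φ ∈ Set.Icc 0 G.near, ∃ ψ ∈ Set.Icc (-E.R) E.R,
    x = p + φ • G.a + ψ • G.b}

/-- The critical point `c`, a corner of the rectangle. -/
def crit (G : E.Gap p) : Plane := p + G.near • G.a + E.R • G.b

/-- The gap sweeper `Δ`: the points reached from the critical point by moving in the direction of
the long ray, up to its end, as long as no collision occurs. -/
def sweeper (G : E.Gap p) : Set Plane :=
  {x | ∃ φ ∈ Set.Icc G.near G.far, x = p + φ • G.a + E.R • G.b ∧
    ∀ φ' ∈ Set.Icc G.near φ, p + φ' • G.a + E.R • G.b ∈ E.free}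

end Gap

/-- A gap for which planning in the corridor has succeeded: `edge` is a shortest path `α` from `p`
to the critical point within the corridor. -/
structure Corridor (E : Environment) (p : Plane) extends E.Gap p where
  edge : Path p toGap.crit
  edge_mem : ∀ t, edge t ∈ toGap.corridor
  edge_finite : pathLength edge ≠ ⊤
  edge_shortest : ∀ β : Path p toGap.crit, (∀ t, β t ∈ toGap.corridor) →
    pathLength edge ≤ pathLength β

/-- The points of the topological tree rooted at `s`, indexed by their position: the root, and the
critical point of each corridor that has been constructed at a point of the tree.  (A critical
point is the source point of the node that arises when it is expanded.) -/
inductive Node (E : Environment) (s : Plane) : Plane → Type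
  | root : Node E s s
  | child {p : Plane} (n : Node E s p) (C : E.Corridor p) : Node E s C.crit

namespace Node

variable {E : Environment} {s : Plane}

/-- The tree path: the concatenation of the edges from the root. -/
def treePath : {p : Plane} → Node E s p → Path s p
  | _, root => Path.refl s
  | _, child n C => n.treePath.trans C.edge

/-- The length `g` of the tree path. -/
def g {p : Plane} (n : Node E s p) : ℝ≥0∞ := pathLength n.treePath

/-- The collision-free paths from `s` to `x` that belong to the distinguished homotopy represented
by a point of the tree.  For the root these are all the collision-free paths.  For a critical point
`c` of a node with source point `p`, they are the collision-free paths that visit `c` so that the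
part up to this visit is homotopic to the tree path of `c` and belongs to the distinguished
homotopy of `p`; what happens after the visit is not restricted. -/
def paths : {p : Plane} → Node E s p → (x : Plane) → Set (Path s x)
  | _, root, _ => {γ | ∀ t, γ t ∈ E.free}
  | _, child n C, _ => {γ | (∀ t, γ t ∈ E.free) ∧ ∃ (t : I) (h : γ t = C.crit),
      let γ' : Path s C.crit := (γ.subpath 0 t).cast γ.source.symm h.symm
      HomotopicIn E.free γ' (child n C).treePath ∧ γ' ∈ n.paths C.crit}

/-- `[n]` beats `[n']` at `x`: the minimal lengths of the paths to `x` in the two distinguished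
homotopies exist, and the one of `[n]` is strictly smaller. -/
def Beats {p p' : Plane} (n : Node E s p) (n' : Node E s p') (x : Plane) : Prop :=
  ∃ L L' : ℝ≥0∞, IsLeast (pathLength '' n.paths x) L ∧ IsLeast (pathLength '' n'.paths x) L' ∧
    L < L'

end Node

end Environment

end

/-!
Along the tree, the minimal length of a path to `m` in a distinguished homotopy is the length of the
tree path plus the length of a shortest collision-free path from its end to `m`. The upper bound is
concatenation, and a shortest free path exists by the direct method. The lower bound holds because
an edge, shortest within its corridor, is also shortest in its homotopy class in the whole free
space: given a homotopy `F` in the free space from a path `β` to the edge and a half plane `H` that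
bounds the corridor rectangle, let `C` be the component of `F ⁻¹' H` that contains the side of the
square on which `F` is the edge. By unicoherence of the square, each component of the complement of
`C` has a connected frontier. It is mapped into the boundary line of `H`, hence onto a segment, and
replacing `F` there by its projection to this segment folds the homotopy into `H`, within the free
space and without lengthening `β`. After four such folds `β` is a path in the corridor.

Hence one homotopy beats another at every point of a gap sweeper as soon as its shortest way to the
critical point of the sweeper is shorter than the tree path; in both parts the way through `q` is.
-/

section Unicoherence

variable {X : Type*} [TopologicalSpace X]

theorem sub_eq_sub_of_coe_addCircle_eq {S : Set X} (hS : IsPreconnected S) {θ v : X → ℝ}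
    (hθ : ContinuousOn θ S) (hv : ContinuousOn v S)
    (h : ∀ z ∈ S, (θ z : AddCircle (1 : ℝ)) = v z) {z w : X} (hz : z ∈ S) (hw : w ∈ S) :
    θ z - v z = θ w - v w := by
  refine hS.constant_of_mapsTo (T := Set.range ((↑) : ℤ → ℝ)) (f := fun z => θ z - v z) ?_
    (hθ.sub hv) (fun z hz => ?_) hz hw
  · rw [← Set.image_univ]
    exact IsDiscrete.univ.image Int.isClosedEmbedding_coe_real.isInducing
  · obtain ⟨n, hn⟩ := (AddCircle.coe_eq_zero_iff (1 : ℝ)).1 <|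
      (AddCircle.coe_sub (p := (1 : ℝ)) (θ z) (v z)).trans (sub_eq_zero.2 (h z hz))
    exact ⟨n, by simpa using hn⟩

theorem exists_continuousMap_eqOn_of_isClosed {Y : Type*} [TopologicalSpace Y] {A B : Set X}
    (hA : IsClosed A) (hB : IsClosed B) (hAB : A ∪ B = Set.univ) {f g : X → Y}
    (hf : Continuous f) (hg : Continuous g) (hfg : Set.EqOn f g (A ∩ B)) :
    ∃ k : C(X, Y), Set.EqOn k f A ∧ Set.EqOn k g B := by
  classical
  have hgB : Set.EqOn (A.piecewise f g) g B := fun z hz => by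
    by_cases hzA : z ∈ A
    · rw [Set.piecewise_eq_of_mem _ _ _ hzA, hfg ⟨hzA, hz⟩]
    · exact Set.piecewise_eq_of_notMem _ _ _ hzA
  refine ⟨⟨A.piecewise f g, ?_⟩, A.piecewise_eqOn f g, hgB⟩
  rw [← continuousOn_univ, ← hAB]
  exact (hf.continuousOn.congr (A.piecewise_eqOn f g)).union_of_isClosed
    (hg.continuousOn.congr hgB) hA hB

variable [SimplyConnectedSpace X] [LocallyPathConnectedSpace X] [NormalSpace X]

/-- If `A ∩ B` were separated by closed sets on which `u = 0` and `u = 1`, a loop that crosses from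
one to the other in `A` and returns in `B` would wind once around the circle under the map given by
`u / 2` on `A` and `-u / 2` on `B`, which lifts to `ℝ`. -/
theorem isPreconnected_inter_of_union_eq_univ {A B : Set X} (hA : IsClosed A) (hB : IsClosed B)
    (cA : IsPreconnected A) (cB : IsPreconnected B) (hAB : A ∪ B = Set.univ) :
    IsPreconnected (A ∩ B) := by
  rw [isPreconnected_closed_iff]
  intro t t' ht ht' hsub ⟨x, hx, hxt⟩ ⟨y, hy, hyt⟩
  by_contra hne
  have hdisj : Disjoint (A ∩ B ∩ t) (A ∩ B ∩ t') := Set.disjoint_left.2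
    fun z hz hz' => hne ⟨z, hz.1, hz.2, hz'.2⟩
  obtain ⟨u, hu0, hu1, -⟩ := exists_continuous_zero_one_of_isClosed
    ((hA.inter hB).inter ht) ((hA.inter hB).inter ht') hdisj
  have hu : Continuous u := u.continuous
  have hagree : Set.EqOn (fun z => ((u z / 2 : ℝ) : AddCircle (1 : ℝ)))
      (fun z => ((-(u z / 2) : ℝ) : AddCircle (1 : ℝ))) (A ∩ B) := by
    intro z hz
    rcases hsub hz with h | h
    · simp [show u z = 0 from hu0 ⟨hz, h⟩]
    · dsimp only
      rw [show u z = 1 from hu1 ⟨hz, h⟩, ← sub_eq_zero, ← AddCircle.coe_sub,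
        AddCircle.coe_eq_zero_iff]
      exact ⟨1, by norm_num⟩
  obtain ⟨f, hfA, hfB⟩ := exists_continuousMap_eqOn_of_isClosed hA hB hAB
    ((AddCircle.continuous_mk' 1).comp (by fun_prop))
    ((AddCircle.continuous_mk' 1).comp (by fun_prop)) hagree
  obtain ⟨θ, ⟨-, hθ⟩, -⟩ := (AddCircle.isCoveringMap_coe (1 : ℝ)).existsUnique_continuousMap_lifts
    f x (u x / 2) (hfA hx.1).symm
  have hA' := sub_eq_sub_of_coe_addCircle_eq cA θ.continuous.continuousOn
    (v := fun z => u z / 2) (by fun_prop) (fun z hz => (congrFun hθ z).trans (hfA hz)) hx.1 hy.1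
  have hB' := sub_eq_sub_of_coe_addCircle_eq cB θ.continuous.continuousOn
    (v := fun z => -(u z / 2)) (by fun_prop) (fun z hz => (congrFun hθ z).trans (hfB hz)) hx.2 hy.2
  have hux : u x = 0 := hu0 ⟨hx, hxt⟩
  have huy : u y = 1 := hu1 ⟨hy, hyt⟩
  linarith

end Unicoherence

section ComplementComponents

variable {X : Type*} [TopologicalSpace X]

theorem isClosed_connectedComponentIn {A : Set X} (hA : IsClosed A) (x : X) :
    IsClosed (connectedComponentIn A x) := by
  by_cases hx : x ∈ A
  · exact isClosed_of_closure_subset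
      (isPreconnected_connectedComponentIn.closure.subset_connectedComponentIn
        (subset_closure (mem_connectedComponentIn hx))
        (closure_minimal (connectedComponentIn_subset _ _) hA))
  · exact (connectedComponentIn_eq_empty hx).symm ▸ isClosed_empty

theorem exists_mem_inter_frontier_of_isPreconnected {S O : Set X} (hS : IsPreconnected S)
    (hO : (S ∩ O).Nonempty) (hO' : (S ∩ Oᶜ).Nonempty) : (S ∩ frontier O).Nonempty := by
  rw [frontier_eq_closure_inter_closure]
  exact isPreconnected_closed_iff.1 hS _ _ isClosed_closure isClosed_closure
    (fun z _ => (em (z ∈ O)).imp (@subset_closure _ _ O z) (@subset_closure _ _ Oᶜ z))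
    (hO.mono (Set.inter_subset_inter_right _ subset_closure))
    (hO'.mono (Set.inter_subset_inter_right _ subset_closure))

theorem disjoint_connectedComponentIn_of_notMem {A : Set X} {x y : X} (hy : y ∈ A)
    (h : y ∉ connectedComponentIn A x) :
    Disjoint (connectedComponentIn A y) (connectedComponentIn A x) :=
  Set.disjoint_left.2 fun _ hwy hwx => h <| connectedComponentIn_eq hwx ▸
    (connectedComponentIn_eq hwy).symm ▸ mem_connectedComponentIn hy

theorem frontier_connectedComponentIn_compl_nonempty [ConnectedSpace X] {C : Set X}
    (cC : C.Nonempty) {x : X} (hx : x ∉ C) : (frontier (connectedComponentIn Cᶜ x)).Nonempty := by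
  obtain ⟨c, hc⟩ := cC
  exact nonempty_frontier_iff.2 ⟨⟨x, mem_connectedComponentIn hx⟩,
    fun h => connectedComponentIn_subset Cᶜ x (h ▸ Set.mem_univ c) hc⟩

section LocallyConnected

variable [LocallyConnectedSpace X] {C : Set X}

theorem frontier_connectedComponentIn_subset (A : Set X) (x : X) :
    frontier (connectedComponentIn A x) ⊆ frontier A := by
  refine fun z hz => ⟨closure_mono (connectedComponentIn_subset A x) hz.1, fun hzA => hz.2 ?_⟩
  have hN : IsOpen (connectedComponentIn (interior A) z) :=
    isOpen_interior.connectedComponentIn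
  obtain ⟨w, hwN, hwx⟩ := mem_closure_iff.1 hz.1 _ hN (mem_connectedComponentIn hzA)
  refine interior_maximal ?_ hN (mem_connectedComponentIn hzA)
  rw [connectedComponentIn_eq hwx]
  exact isPreconnected_connectedComponentIn.subset_connectedComponentIn hwN
    ((connectedComponentIn_subset _ _).trans interior_subset)

theorem frontier_connectedComponentIn_compl_subset (hC : IsClosed C) (x : X) :
    frontier (connectedComponentIn Cᶜ x) ⊆ C :=
  (frontier_connectedComponentIn_subset Cᶜ x).trans (frontier_compl C ▸ hC.frontier_subset)

theorem isPreconnected_compl_connectedComponentIn_compl [ConnectedSpace X] (hC : IsClosed C)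
    (cC : IsConnected C) (x : X) : IsPreconnected (connectedComponentIn Cᶜ x)ᶜ := by
  obtain ⟨⟨c, hc⟩, cC⟩ := cC
  have hCO : C ⊆ (connectedComponentIn Cᶜ x)ᶜ :=
    Set.subset_compl_comm.1 (connectedComponentIn_subset _ _)
  refine isPreconnected_of_forall c fun y hy => ?_
  by_cases hyC : y ∈ C
  · exact ⟨C, hCO, hc, hyC, cC⟩
  obtain ⟨z, hz⟩ := frontier_connectedComponentIn_compl_nonempty ⟨c, hc⟩ hyC
  have hdisj : closure (connectedComponentIn Cᶜ y) ⊆ (connectedComponentIn Cᶜ x)ᶜ :=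
    ((disjoint_connectedComponentIn_of_notMem hyC hy).closure_left
      hC.isOpen_compl.connectedComponentIn).subset_compl_right
  exact ⟨C ∪ closure (connectedComponentIn Cᶜ y), Set.union_subset hCO hdisj, Or.inl hc,
    Or.inr (subset_closure (mem_connectedComponentIn hyC)), cC.union z
      (frontier_connectedComponentIn_compl_subset hC y hz) (frontier_subset_closure hz)
      isPreconnected_connectedComponentIn.closure⟩

end LocallyConnected

theorem isPreconnected_frontier_connectedComponentIn_compl [SimplyConnectedSpace X]
    [LocallyPathConnectedSpace X] [NormalSpace X] {C : Set X} (hC : IsClosed C) (cC : IsConnected C)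
    (x : X) : IsPreconnected (frontier (connectedComponentIn Cᶜ x)) := by
  have hO := hC.isOpen_compl.connectedComponentIn (x := x)
  rw [frontier_eq_closure_inter_closure, hO.isClosed_compl.closure_eq]
  exact isPreconnected_inter_of_union_eq_univ isClosed_closure hO.isClosed_compl
    isPreconnected_connectedComponentIn.closure
    (isPreconnected_compl_connectedComponentIn_compl hC cC x)
    (Set.eq_univ_of_forall fun y => (em _).imp_left fun h => subset_closure h)

end ComplementComponents

section NonexpansiveRetract

/-- `J` is the image of a nonexpansive retraction. Across such a set, a map can be folded back
without lengthening any curve. -/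
def IsNonexpansiveRetract {Y : Type*} [PseudoEMetricSpace Y] (J : Set Y) : Prop :=
  ∃ ρ : Y → Y, LipschitzWith 1 ρ ∧ (∀ y, ρ y ∈ J) ∧ ∀ y ∈ J, ρ y = y

/-- A closed set into which maps can be folded along its frontier: each piece of the frontier onto
which a folded region may have to be retracted is a nonexpansive retract. -/
structure IsFoldable {Y : Type*} [PseudoEMetricSpace Y] (H : Set Y) : Prop where
  isClosed : IsClosed H
  isNonexpansiveRetract : ∀ {J : Set Y}, J ⊆ frontier H → IsClosed J → IsConnected J →
    IsNonexpansiveRetract J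

variable {V : Type*} [NormedAddCommGroup V] [InnerProductSpace ℝ V]

theorem norm_sub_le_of_inner_sub_nonpos {x y p q : V} (hp : inner ℝ (x - p) (q - p) ≤ 0)
    (hq : inner ℝ (y - q) (p - q) ≤ 0) : ‖p - q‖ ≤ ‖x - y‖ := by
  have hinner : inner ℝ (p - q) (p - q) ≤ inner ℝ (x - y) (p - q) := by
    have hsum : inner ℝ (x - p) (q - p) + inner ℝ (y - q) (p - q)
        = inner ℝ (p - q) (p - q) - inner ℝ (x - y) (p - q) := by
      simp only [inner_sub_left, inner_sub_right]
      ring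
    linarith
  have hsq : ‖p - q‖ * ‖p - q‖ ≤ ‖x - y‖ * ‖p - q‖ :=
    (real_inner_self_eq_norm_mul_norm (p - q)).symm.trans_le
      (hinner.trans (real_inner_le_norm _ _))
  rcases (norm_nonneg (p - q)).eq_or_lt with h | h
  · exact h ▸ norm_nonneg _
  · exact le_of_mul_le_mul_right hsq h

theorem isNonexpansiveRetract_of_convex {J : Set V} (hne : J.Nonempty) (hJ : IsComplete J)
    (cJ : Convex ℝ J) : IsNonexpansiveRetract J := by
  choose ρ hρJ hρ using exists_norm_eq_iInf_of_complete_convex hne hJ cJ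
  have hinner : ∀ x, ∀ w ∈ J, inner ℝ (x - ρ x) (w - ρ x) ≤ 0 := fun x =>
    (norm_eq_iInf_iff_real_inner_le_zero cJ (hρJ x)).1 (hρ x)
  refine ⟨ρ, LipschitzWith.of_dist_le_mul fun x y => ?_, hρJ, fun y hy => ?_⟩
  · rw [NNReal.coe_one, one_mul, dist_eq_norm, dist_eq_norm]
    exact norm_sub_le_of_inner_sub_nonpos (hinner x _ (hρJ y)) (hinner y _ (hρJ x))
  · have h := hinner y y hy
    rw [real_inner_self_nonpos, sub_eq_zero] at h
    exact h.symm

theorem convex_of_isPreconnected_of_collinear {J : Set V} (cJ : IsPreconnected J)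
    (hJ : Collinear ℝ J) : Convex ℝ J := by
  obtain ⟨p, v, hv⟩ := (collinear_iff_exists_forall_eq_smul_vadd J).1 hJ
  let line : ℝ →ᵃ[ℝ] V := AffineMap.lineMap p (p + v)
  have hline : ∀ t, line t = t • v + p := fun t => by simp [line, AffineMap.lineMap_apply]
  rcases eq_or_ne v 0 with rfl | hv0
  · refine Set.Subsingleton.convex fun x hx y hy => ?_
    obtain ⟨s, rfl⟩ := hv x hx
    obtain ⟨t, rfl⟩ := hv y hy
    simp
  have hind : Topology.IsInducing line := by
    have : (line : ℝ → V) = (Homeomorph.addRight p) ∘ fun t => t • v := by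
      ext t; simp [hline]
    rw [this]
    exact (Homeomorph.addRight p).isInducing.comp (isClosedEmbedding_smul_left hv0).isInducing
  have himage : line '' (line ⁻¹' J) = J := Set.image_preimage_eq_of_subset fun x hx => by
    obtain ⟨t, rfl⟩ := hv x hx
    exact ⟨t, hline t⟩
  rw [← himage]
  refine Convex.affine_image line (Real.convex_iff_isPreconnected.2 ?_)
  rw [← hind.isPreconnected_image, himage]
  exact cJ

theorem collinear_setOf_inner_eq [Fact (Module.finrank ℝ V = 2)] {u : V} (hu : u ≠ 0) (r : ℝ) :
    Collinear ℝ {x : V | inner ℝ u x = r} := by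
  have : FiniteDimensional ℝ V := .of_fact_finrank_eq_two
  rw [collinear_iff_finrank_le_one]
  have hspan : vectorSpan ℝ {x : V | inner ℝ u x = r} ≤ (Submodule.span ℝ {u})ᗮ := by
    rw [vectorSpan, Submodule.span_le]
    rintro _ ⟨x, hx, y, hy, rfl⟩
    refine Submodule.mem_orthogonal_singleton_iff_inner_right.2 ?_
    exact (inner_sub_right u x y).trans (sub_eq_zero.2 (Eq.trans hx (Eq.symm hy)))
  have : Fact (Module.finrank ℝ V = 1 + 1) := ‹_›
  exact (Submodule.finrank_mono hspan).trans_eq (Submodule.finrank_orthogonal_span_singleton hu)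

theorem isFoldable_halfPlane [Fact (Module.finrank ℝ V = 2)] {u : V} (hu : u ≠ 0) (r : ℝ) :
    IsFoldable {x | inner ℝ u x ≤ r} where
  isClosed := isClosed_le (by fun_prop) (by fun_prop)
  isNonexpansiveRetract {J} hJ hJc cJ := by
    have : FiniteDimensional ℝ V := .of_fact_finrank_eq_two
    have hline : J ⊆ {x | inner ℝ u x = r} :=
      hJ.trans (frontier_le_subset_eq (by fun_prop) (by fun_prop))
    exact isNonexpansiveRetract_of_convex cJ.nonempty hJc.isComplete
      (convex_of_isPreconnected_of_collinear cJ.isPreconnected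
        ((collinear_setOf_inner_eq hu r).subset hline))

end NonexpansiveRetract

section Fold

variable {X Y : Type*} [TopologicalSpace X] [PseudoMetricSpace Y]

/-- `G` arises from `F` by folding on the complement of `C`, where both maps agree on `C`: two
points of a connected set `S` whose distance under `G` exceeds that under `F` are separated by `C`
in `S`, and `G` is nonexpansive relative to `F` up to a point of `C` in between. -/
structure IsFold (F G : X → Y) (C : Set X) : Prop where
  eqOn : Set.EqOn G F C
  dist_le : ∀ {S : Set X}, IsPreconnected S → ∀ {x y : X}, x ∈ S → y ∈ S →
    dist (G x) (G y) ≤ dist (F x) (F y) ∨ ∃ z ∈ S ∩ C, dist (G x) (G z) ≤ dist (F x) (F z)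

namespace IsFold

variable {F G : X → Y} {C S : Set X}

theorem exists_mem_dist_le (h : IsFold F G C) (hS : IsPreconnected S) (hSC : (S ∩ C).Nonempty)
    {x : X} (hx : x ∈ S) : ∃ z ∈ S ∩ C, dist (G x) (G z) ≤ dist (F x) (F z) := by
  obtain ⟨z, hz⟩ := hSC
  exact (h.dist_le hS hx hz.1).elim (fun hle => ⟨z, hz, hle⟩) id

theorem exists_dist_le_add (h : IsFold F G C) (hS : IsPreconnected S) {x y : X} (hx : x ∈ S)
    (hy : y ∈ S) : ∃ z ∈ S, ∃ w ∈ S,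
      dist (G x) (G y) ≤ dist (F x) (F z) + dist (F z) (F w) + dist (F w) (F y) := by
  rcases h.dist_le hS hx hy with hle | ⟨z, hz, hxz⟩
  · exact ⟨y, hy, y, hy, by simpa using hle⟩
  · obtain ⟨w, hw, hyw⟩ := h.exists_mem_dist_le hS ⟨z, hz⟩ hy
    refine ⟨z, hz.1, w, hw.1, (dist_triangle4 _ (G z) (G w) _).trans ?_⟩
    rw [h.eqOn hz.2, h.eqOn hw.2] at *
    rw [dist_comm (F w) (G y), dist_comm (F w) (F y)]
    gcongr

theorem continuous [LocallyConnectedSpace X] (h : IsFold F G C) (hF : Continuous F) :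
    Continuous G := by
  rw [continuous_iff_continuousAt]
  intro x
  rw [Metric.continuousAt_iff']
  intro ε hε
  set U := F ⁻¹' Metric.ball (F x) (ε / 5)
  have hU : U ∈ nhds x := hF.continuousAt.preimage_mem_nhds (Metric.ball_mem_nhds _ (by linarith))
  have hclose : ∀ z ∈ connectedComponentIn U x, dist (F z) (F x) < ε / 5 := fun z hz =>
    Metric.mem_ball.1 (connectedComponentIn_subset U x hz)
  filter_upwards [connectedComponentIn_mem_nhds hU] with y hy
  obtain ⟨z, hz, w, hw, hle⟩ := h.exists_dist_le_add isPreconnected_connectedComponentIn hy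
    (mem_connectedComponentIn (mem_of_mem_nhds hU))
  have hyz := dist_triangle_right (F y) (F z) (F x)
  have hzw := dist_triangle_right (F z) (F w) (F x)
  linarith [hclose y hy, hclose z hz, hclose w hw]

theorem comp {Z : Type*} [TopologicalSpace Z] (h : IsFold F G C) {γ : Z → X}
    (hγ : Continuous γ) : IsFold (F ∘ γ) (G ∘ γ) (γ ⁻¹' C) where
  eqOn _ hz := h.eqOn hz
  dist_le {S} hS x y hx hy := by
    refine (h.dist_le (hS.image γ hγ.continuousOn) (Set.mem_image_of_mem γ hx)
      (Set.mem_image_of_mem γ hy)).imp_right ?_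
    rintro ⟨_, ⟨⟨z, hz, rfl⟩, hzC⟩, hle⟩
    exact ⟨z, ⟨hz, hzC⟩, hle⟩

end IsFold

theorem eVariationOn_univ_le_of_edist_le {α E E' : Type*} [LinearOrder α] [PseudoEMetricSpace E]
    [PseudoEMetricSpace E'] {f : α → E} {g : α → E'}
    (h : ∀ s s', s ≤ s' → edist (f s) (f s') ≤ eVariationOn g (Set.Icc s s')) :
    eVariationOn f Set.univ ≤ eVariationOn g Set.univ := by
  refine iSup_le fun ⟨n, w, hw, _⟩ => ?_
  calc ∑ i ∈ Finset.range n, edist (f (w (i + 1))) (f (w i))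
      ≤ ∑ i ∈ Finset.range n, eVariationOn g (Set.Icc (w i) (w (i + 1))) :=
        Finset.sum_le_sum fun i _ => edist_comm (f (w i)) _ ▸ h _ _ (hw i.le_succ)
    _ = eVariationOn g (Set.Icc (w 0) (w n)) := eVariationOn.sum' g hw
    _ ≤ eVariationOn g Set.univ := eVariationOn.mono g (Set.subset_univ _)

theorem edist_add_edist_add_edist_le_eVariationOn {α E : Type*} [LinearOrder α]
    [PseudoEMetricSpace E] (f : α → E) {s z w s' : α} (hsz : s ≤ z) (hzw : z ≤ w) (hws : w ≤ s') :
    edist (f s) (f z) + edist (f z) (f w) + edist (f w) (f s')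
      ≤ eVariationOn f (Set.Icc s s') := by
  have hle : ∀ {x y : α}, x ≤ y → edist (f x) (f y) ≤ eVariationOn f (Set.Icc x y) := fun h =>
    eVariationOn.edist_le f (Set.left_mem_Icc.2 h) (Set.right_mem_Icc.2 h)
  have hadd : ∀ {x y z : α}, x ≤ y → y ≤ z → eVariationOn f (Set.Icc x y)
      + eVariationOn f (Set.Icc y z) = eVariationOn f (Set.Icc x z) := fun hxy hyz => by
    simpa using eVariationOn.Icc_add_Icc f (s := Set.univ) hxy hyz (Set.mem_univ _)
  rw [← hadd (hsz.trans hzw) hws, ← hadd hsz hzw]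
  exact add_le_add (add_le_add (hle hsz) (hle hzw)) (hle hws)

theorem IsFold.eVariationOn_le {α : Type*} [ConditionallyCompleteLinearOrder α]
    [TopologicalSpace α] [OrderTopology α] [DenselyOrdered α] {f g : α → Y} {C : Set α}
    (h : IsFold f g C) : eVariationOn g Set.univ ≤ eVariationOn f Set.univ := by
  have hedist : ∀ {x y : α}, dist (g x) (g y) ≤ dist (f x) (f y) →
      edist (g x) (g y) ≤ edist (f x) (f y) := fun hle => by
    simpa only [edist_dist] using ENNReal.ofReal_le_ofReal hle
  refine eVariationOn_univ_le_of_edist_le fun s s' hs => ?_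
  rcases h.dist_le isPreconnected_Icc (Set.left_mem_Icc.2 hs) (Set.right_mem_Icc.2 hs) with
    hle | ⟨z, ⟨hz, hzC⟩, hsz⟩
  · exact (hedist hle).trans
      (eVariationOn.edist_le f (Set.left_mem_Icc.2 hs) (Set.right_mem_Icc.2 hs))
  obtain ⟨w, ⟨hw, hwC⟩, hsw⟩ := h.exists_mem_dist_le (isPreconnected_Icc (a := z) (b := s'))
    ⟨z, Set.left_mem_Icc.2 hz.2, hzC⟩ (Set.right_mem_Icc.2 hz.2)
  calc edist (g s) (g s')
      ≤ edist (g s) (g z) + edist (g z) (g w) + edist (g w) (g s') := edist_triangle4 _ _ _ _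
    _ ≤ edist (f s) (f z) + edist (f z) (f w) + edist (f w) (f s') := by
        refine add_le_add (add_le_add (hedist hsz) ?_) ?_
        · rw [h.eqOn hzC, h.eqOn hwC]
        · rw [edist_comm (g w), edist_comm (f w)]
          exact hedist hsw
    _ ≤ eVariationOn f (Set.Icc s s') :=
        edist_add_edist_add_edist_le_eVariationOn f hz.1 hw.1 hw.2

theorem isFold_piecewise [LocallyConnectedSpace X] {C : Set X} [DecidablePred (· ∈ C)]
    (hC : IsClosed C) (F : X → Y) {ρ : Set X → Y → Y}
    (hρ : ∀ x ∉ C, LipschitzWith 1 (ρ (connectedComponentIn Cᶜ x)))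
    (hρF : ∀ x ∉ C, ∀ z ∈ frontier (connectedComponentIn Cᶜ x),
      ρ (connectedComponentIn Cᶜ x) (F z) = F z) :
    IsFold F (C.piecewise F fun z => ρ (connectedComponentIn Cᶜ z) (F z)) C := by
  refine ⟨C.piecewise_eqOn F _, fun {S} hS x y hx hy => ?_⟩
  by_cases hxC : x ∈ C
  · exact Or.inr ⟨x, ⟨hx, hxC⟩, by rw [dist_self]; exact dist_nonneg⟩
  have hnonexp : ∀ p q, dist (ρ (connectedComponentIn Cᶜ x) p) (ρ (connectedComponentIn Cᶜ x) q)
      ≤ dist p q := fun p q => by simpa using (hρ x hxC).dist_le_mul p q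
  rw [Set.piecewise_eq_of_notMem _ _ _ hxC]
  by_cases hyO : y ∈ connectedComponentIn Cᶜ x
  · left
    rw [Set.piecewise_eq_of_notMem _ _ _ (connectedComponentIn_subset _ _ hyO),
      ← connectedComponentIn_eq hyO]
    exact hnonexp _ _
  · obtain ⟨z, hz, hzO⟩ := exists_mem_inter_frontier_of_isPreconnected hS
      ⟨x, hx, mem_connectedComponentIn hxC⟩ ⟨y, hy, hyO⟩
    have hzC : z ∈ C := frontier_connectedComponentIn_compl_subset hC x hzO
    refine Or.inr ⟨z, ⟨hz, hzC⟩, ?_⟩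
    rw [Set.piecewise_eq_of_mem _ _ _ hzC]
    exact (hρF x hxC z hzO ▸ hnonexp (F x) (F z) :)

variable [SimplyConnectedSpace X] [LocallyPathConnectedSpace X] [NormalSpace X]

theorem isNonexpansiveRetract_closure_image_frontier {F : X → Y} (hF : Continuous F) {H : Set Y}
    (hH : IsFoldable H) {x₀ x : X}
    (hx₀ : F x₀ ∈ H) (hx : x ∉ connectedComponentIn (F ⁻¹' H) x₀) :
    IsNonexpansiveRetract
      (closure (F '' frontier (connectedComponentIn (connectedComponentIn (F ⁻¹' H) x₀)ᶜ x))) := by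
  set C := connectedComponentIn (F ⁻¹' H) x₀
  have hC : IsClosed C := isClosed_connectedComponentIn (hH.isClosed.preimage hF) x₀
  have cC : IsConnected C := isConnected_connectedComponentIn_iff.2 hx₀
  have hfrontier : frontier (connectedComponentIn Cᶜ x) ⊆ F ⁻¹' frontier H :=
    calc frontier (connectedComponentIn Cᶜ x) ⊆ frontier Cᶜ :=
          frontier_connectedComponentIn_subset Cᶜ x
      _ = frontier C := frontier_compl C
      _ ⊆ frontier (F ⁻¹' H) := frontier_connectedComponentIn_subset _ x₀
      _ ⊆ F ⁻¹' frontier H := hF.frontier_preimage_subset H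
  have hconn : IsConnected (frontier (connectedComponentIn Cᶜ x)) :=
    ⟨frontier_connectedComponentIn_compl_nonempty cC.nonempty hx,
      isPreconnected_frontier_connectedComponentIn_compl hC cC x⟩
  exact hH.isNonexpansiveRetract
    (closure_minimal (Set.image_subset_iff.2 hfrontier) isClosed_frontier)
    isClosed_closure (hconn.image F hF.continuousOn).closure

/-- Each component of the complement of `C` is mapped by `F` and then retracted onto the image of
its frontier, which is a connected subset of the frontier of `H`. -/
theorem exists_isFold_forall_mem {F : X → Y} (hF : Continuous F) {M H : Set Y} (hM : IsClosed M)
    (hFM : ∀ x, F x ∈ M) (hH : IsFoldable H) {x₀ : X}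
    (hx₀ : F x₀ ∈ H) :
    ∃ G : X → Y, IsFold F G (connectedComponentIn (F ⁻¹' H) x₀) ∧ ∀ x, G x ∈ M ∩ H := by
  classical
  set C := connectedComponentIn (F ⁻¹' H) x₀
  have hC : IsClosed C := isClosed_connectedComponentIn (hH.isClosed.preimage hF) x₀
  have hCH : C ⊆ F ⁻¹' H := connectedComponentIn_subset _ _
  let J : Set X → Set Y := fun A => closure (F '' frontier A)
  have hJ : ∀ x, J (connectedComponentIn Cᶜ x) ⊆ M ∩ H := fun x => closure_minimal
    (Set.image_subset_iff.2 fun z hz =>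
      ⟨hFM z, hCH (frontier_connectedComponentIn_compl_subset hC x hz)⟩) (hM.inter hH.isClosed)
  have hret : ∀ x ∉ C, IsNonexpansiveRetract (J (connectedComponentIn Cᶜ x)) := fun x hx =>
    isNonexpansiveRetract_closure_image_frontier hF hH hx₀ hx
  have : Nonempty (Y → Y) := ⟨id⟩
  choose! ρ hρ hρJ hρid using fun A (hA : IsNonexpansiveRetract (J A)) => hA
  refine ⟨_, isFold_piecewise hC F (fun x hx => hρ _ (hret x hx)) fun x hx z hz =>
    hρid _ (hret x hx) _ (subset_closure (Set.mem_image_of_mem F hz)), fun z => ?_⟩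
  by_cases hz : z ∈ C
  · rw [Set.piecewise_eq_of_mem _ _ _ hz]
    exact ⟨hFM z, hCH hz⟩
  · rw [Set.piecewise_eq_of_notMem _ _ _ hz]
    exact hJ z (hρJ _ (hret z hz) _)

end Fold

section FoldHomotopy

instance : LocallyPathConnectedSpace I :=
  (isQuotientMap_projIcc (h := zero_le_one)).locallyPathConnectedSpace

instance : ContractibleSpace I := (convex_Icc (0 : ℝ) 1).contractibleSpace ⟨0, by simp⟩

theorem mem_connectedComponentIn_of_continuous {X Z : Type*} [TopologicalSpace X]
    [TopologicalSpace Z] [PreconnectedSpace Z] {A : Set X} {x : X} {f : Z → X}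
    (hf : Continuous f) (hfA : ∀ t, f t ∈ A) {s : Z} (hs : f s ∈ connectedComponentIn A x) (t : Z) :
    f t ∈ connectedComponentIn A x := by
  rw [connectedComponentIn_eq hs]
  exact (isPreconnected_range hf).subset_connectedComponentIn ⟨s, rfl⟩
    (Set.range_subset_iff.2 hfA) ⟨t, rfl⟩

variable {Y : Type*} [PseudoMetricSpace Y] {x y : Y} {M : Set Y} {α β : Path x y}

theorem exists_homotopy_mem_inter (hM : IsClosed M) {H : Set Y} (hH : IsFoldable H)
    (F : β.Homotopy α) (hFM : ∀ z, F z ∈ M) (hα : ∀ t, α t ∈ H) :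
    ∃ (β' : Path x y) (G : β'.Homotopy α), (∀ z, G z ∈ M ∩ H) ∧
      eVariationOn β' Set.univ ≤ eVariationOn β Set.univ := by
  have hFH : ∀ z : I × I, z.1 = 1 ∨ z.2 = 0 ∨ z.2 = 1 → F z ∈ H := by
    rintro ⟨s, t⟩ (rfl | rfl | rfl)
    · simpa using hα t
    · simpa using hα 0
    · simpa using hα 1
  obtain ⟨G, hG, hGMH⟩ := exists_isFold_forall_mem F.continuous hM hFM hH (hFH (1, 0) (by simp))
  have hGc : Continuous G := hG.continuous F.continuous
  set C := connectedComponentIn (F ⁻¹' H) (1, 0)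
  have hC1 : ∀ t, ((1, t) : I × I) ∈ C := mem_connectedComponentIn_of_continuous (s := 0)
    (by fun_prop) (fun t => hFH (1, t) (by simp)) (mem_connectedComponentIn (hFH (1, 0) (by simp)))
  have hGF : ∀ z : I × I, z.1 = 1 ∨ z.2 = 0 ∨ z.2 = 1 → G z = F z := by
    rintro ⟨s, t⟩ (rfl | rfl | rfl)
    · exact hG.eqOn (hC1 t)
    · exact hG.eqOn <| mem_connectedComponentIn_of_continuous (f := fun s : I => (s, (0 : I)))
        (by fun_prop) (fun s => hFH (s, 0) (by simp)) (hC1 0) s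
    · exact hG.eqOn <| mem_connectedComponentIn_of_continuous (f := fun s : I => (s, (1 : I)))
        (by fun_prop) (fun s => hFH (s, 1) (by simp)) (hC1 1) s
  have hG0 : ∀ s : I, G (s, 0) = x := fun s => (hGF _ (by simp)).trans (F.source s)
  have hG1 : ∀ s : I, G (s, 1) = y := fun s => (hGF _ (by simp)).trans (F.target s)
  let β' : Path x y := ⟨⟨fun t => G (0, t), by fun_prop⟩, hG0 0, hG1 0⟩
  refine ⟨β', ⟨⟨⟨G, hGc⟩, fun t => rfl, fun t => (hGF _ (by simp)).trans (F.apply_one t)⟩, ?_⟩,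
    hGMH, ?_⟩
  · rintro s t (rfl | rfl)
    · exact (hG0 s).trans (hG0 0).symm
    · exact (hG1 s).trans (hG1 0).symm
  · have hβ : F ∘ (fun t : I => ((0, t) : I × I)) = β := funext F.apply_zero
    rw [← hβ]
    exact (hG.comp (by fun_prop : Continuous fun t : I => ((0, t) : I × I))).eVariationOn_le

theorem exists_homotopy_mem_inter_biInter (hM : IsClosed M) {ι : Type*} (s : Finset ι)
    {H : ι → Set Y} (hH : ∀ i ∈ s, IsFoldable (H i)) (F : β.Homotopy α) (hFM : ∀ z, F z ∈ M)
    (hα : ∀ i ∈ s, ∀ t, α t ∈ H i) :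
    ∃ (β' : Path x y) (G : β'.Homotopy α), (∀ z, G z ∈ M ∩ ⋂ i ∈ s, H i) ∧
      eVariationOn β' Set.univ ≤ eVariationOn β Set.univ := by
  classical
  induction s using Finset.induction_on with
  | empty => exact ⟨β, F, by simpa using hFM, le_rfl⟩
  | insert i s _ ih =>
    rw [Finset.forall_mem_insert] at hH hα
    obtain ⟨β₁, F₁, hF₁, hle₁⟩ := ih hH.2 hα.2
    obtain ⟨β₂, F₂, hF₂, hle₂⟩ := exists_homotopy_mem_inter
      (hM.inter (isClosed_biInter fun j hj => (hH.2 j hj).isClosed)) hH.1 F₁ hF₁ hα.1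
    refine ⟨β₂, F₂, fun z => ?_, hle₂.trans hle₁⟩
    rw [Finset.set_biInter_insert]
    exact ⟨(hF₂ z).1.1, (hF₂ z).2, (hF₂ z).1.2⟩

theorem eVariationOn_le_of_homotopy (hM : IsClosed M) {ι : Type*} {s : Finset ι} {H : ι → Set Y}
    (hH : ∀ i ∈ s, IsFoldable (H i)) (hα : ∀ i ∈ s, ∀ t, α t ∈ H i)
    (hmin : ∀ γ : Path x y, (∀ t, γ t ∈ M ∩ ⋂ i ∈ s, H i) →
      eVariationOn α Set.univ ≤ eVariationOn γ Set.univ)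
    (F : β.Homotopy α) (hFM : ∀ z, F z ∈ M) :
    eVariationOn α Set.univ ≤ eVariationOn β Set.univ := by
  obtain ⟨β', G, hG, hle⟩ := exists_homotopy_mem_inter_biInter hM s hH F hFM hα
  exact (hmin β' fun t => G.apply_zero t ▸ hG (0, t)).trans hle

end FoldHomotopy

section Corridor

theorem eq_inner_smul_add_inner_smul {V : Type*} [NormedAddCommGroup V] [InnerProductSpace ℝ V]
    [Fact (Module.finrank ℝ V = 2)] {a b : V} (ha : ‖a‖ = 1) (hb : ‖b‖ = 1)
    (hab : inner ℝ a b = 0) (x : V) : x = inner ℝ a x • a + inner ℝ b x • b := by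
  have : FiniteDimensional ℝ V := .of_fact_finrank_eq_two
  have hon : Orthonormal ℝ ![a, b] := by
    simp [orthonormal_vecCons_iff, ha, hb, hab]
  have hcard : Fintype.card (Fin 2) = Module.finrank ℝ V := by
    rw [Fintype.card_fin, Fact.out (p := Module.finrank ℝ V = 2)]
  let B := OrthonormalBasis.mk hon (hon.linearIndependent.span_eq_top_of_card_eq_finrank' hcard).ge
  simpa [B, Fin.sum_univ_two] using (B.sum_repr' x).symm

open scoped EuclideanSpace

namespace Environment

variable {E : Environment} {p : Plane}

theorem isClosed_free : IsClosed E.free := by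
  simp only [free, Set.ofPred_forall]
  exact isClosed_biInter fun o _ => isClosed_le (by fun_prop) (by fun_prop)

theorem Gap.mem_corridor_iff (G : E.Gap p) {x : Plane} : x ∈ G.corridor ↔ x ∈ E.free ∧
    inner ℝ G.a (x - p) ∈ Set.Icc 0 G.near ∧ inner ℝ G.b (x - p) ∈ Set.Icc (-E.R) E.R := by
  refine and_congr_right fun _ => ⟨?_, fun ⟨hφ, hψ⟩ => ⟨_, hφ, _, hψ, ?_⟩⟩
  · rintro ⟨φ, hφ, ψ, hψ, rfl⟩
    rw [add_assoc, add_sub_cancel_left]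
    simpa [inner_add_right, inner_smul_right, G.far_ray.1, G.norm_b, G.inner_ab,
      real_inner_comm G.a G.b] using And.intro hφ hψ
  · rw [add_assoc, ← eq_inner_smul_add_inner_smul G.far_ray.1 G.norm_b G.inner_ab,
      add_sub_cancel]

theorem Corridor.pathLength_edge_le (C : E.Corridor p) {β : Path p C.crit}
    (h : HomotopicIn E.free β C.edge) : pathLength C.edge ≤ pathLength β := by
  obtain ⟨F, hF⟩ := h
  let H : Fin 4 → Set Plane := fun i =>
    {x | inner ℝ (![C.a, -C.a, C.b, -C.b] i) x ≤ ![inner ℝ C.a p + C.near, -inner ℝ C.a p,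
      inner ℝ C.b p + E.R, E.R - inner ℝ C.b p] i}
  have ha : C.a ≠ 0 := norm_ne_zero_iff.1 (C.far_ray.1 ▸ one_ne_zero)
  have hb : C.b ≠ 0 := norm_ne_zero_iff.1 (C.norm_b ▸ one_ne_zero)
  have hH : ∀ i, IsFoldable (H i) := fun i => isFoldable_halfPlane
    (by fin_cases i <;> simpa) _
  have hcorridor : C.corridor = E.free ∩ ⋂ i ∈ Finset.univ, H i := by
    ext x
    simp only [C.mem_corridor_iff, inner_sub_right, Set.mem_Icc, Finset.mem_univ, Set.iInter_true,
      Set.mem_inter_iff, Set.mem_iInter, Set.mem_ofPred_eq, Fin.forall_fin_succ, Fin.isValue,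
      Matrix.cons_val_zero, Matrix.cons_val_succ, inner_neg_left, Matrix.cons_val_fin_one,
      forall_const, and_congr_right_iff, H]
    grind
  exact eVariationOn_le_of_homotopy isClosed_free (fun i _ => hH i)
    (fun i hi t => Set.mem_iInter₂.1 (hcorridor ▸ C.edge_mem t).2 i hi)
    (fun γ hγ => C.edge_shortest γ (hcorridor ▸ hγ)) F hF

end Environment

end Corridor

section PathLength

theorem continuous_variationOnFromTo {α E : Type*} [LinearOrder α] [TopologicalSpace α]
    [OrderTopology α] [PseudoMetricSpace E] {f : α → E}
    (hf : LocallyBoundedVariationOn f Set.univ) (hc : Continuous f) (a : α) :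
    Continuous (variationOnFromTo f Set.univ a) := by
  refine continuous_iff_continuousAt.2 fun b =>
    continuousAt_iff_continuous_left'_right'.2 ⟨?_, ?_⟩
  · simpa [ContinuousWithinAt] using variationOnFromTo.tendsto_left (Set.mem_univ a)
      (Set.mem_univ b) hf (hc.tendsto b |>.mono_left nhdsWithin_le_nhds)
  · simpa [ContinuousWithinAt] using variationOnFromTo.tendsto_right (Set.mem_univ a)
      (Set.mem_univ b) hf (hc.tendsto b |>.mono_left nhdsWithin_le_nhds)

theorem dist_le_dist_variationOnFromTo {α E : Type*} [LinearOrder α] [PseudoMetricSpace E]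
    {f : α → E} {s : Set α} (hf : LocallyBoundedVariationOn f s) {a b c : α} (ha : a ∈ s)
    (hb : b ∈ s) (hc : c ∈ s) :
    dist (f b) (f c) ≤ dist (variationOnFromTo f s a b) (variationOnFromTo f s a c) := by
  wlog hbc : b ≤ c generalizing b c
  · simpa only [dist_comm] using this hc hb (le_of_not_ge hbc)
  rw [dist_comm (variationOnFromTo f s a b), Real.dist_eq, variationOnFromTo.sub_right hf ha hc hb,
    abs_of_nonneg (variationOnFromTo.nonneg_of_le f s hbc), variationOnFromTo.eq_of_le f s hbc,
    dist_edist]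
  exact ENNReal.toReal_mono (hf b c hb hc)
    (eVariationOn.edist_le f ⟨hb, le_rfl, hbc⟩ ⟨hc, hbc, le_rfl⟩)

theorem eVariationOn_univ_le_of_lipschitzWith {Y : Type*} [PseudoEMetricSpace Y] {f : I → Y}
    {K : NNReal} (hf : LipschitzWith K f) : eVariationOn f Set.univ ≤ K := by
  have hid : eVariationOn (id : I → I) Set.univ = 1 := by
    change eVariationOn (Subtype.val : I → ℝ) Set.univ = 1
    simpa [← unitInterval.univ_eq_Icc] using MonotoneOn.eVariationOn_eq (s := Set.univ)
      (Subtype.mono_coe (α := ℝ) (· ∈ I) |>.monotoneOn _)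
      (Set.mem_univ (0 : I)) (Set.mem_univ 1)
  simpa only [Function.comp_id, hid, mul_one] using
    hf.lipschitzOnWith.comp_eVariationOn_le (Set.mapsTo_univ (id : I → I) Set.univ)

theorem exists_lipschitzWith_path_range_subset {Y : Type*} [MetricSpace Y] {x y : Y} (γ : Path x y)
    (hγ : eVariationOn γ Set.univ ≠ ⊤) :
    ∃ δ : Path x y, LipschitzWith (eVariationOn γ Set.univ).toNNReal δ ∧
      Set.range δ ⊆ Set.range γ := by
  have hloc : LocallyBoundedVariationOn γ Set.univ :=
    BoundedVariationOn.locallyBoundedVariationOn hγ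
  set V : I → ℝ := variationOnFromTo γ Set.univ 0
  have hV0 : V 0 = 0 := variationOnFromTo.self _ _ _
  have hV1 : V 1 = (eVariationOn γ Set.univ).toNNReal := by
    rw [show V 1 = _ from variationOnFromTo.eq_of_le γ _ zero_le_one, Set.univ_inter,
      ← unitInterval.univ_eq_Icc, ENNReal.coe_toNNReal_eq_toReal]
  have hdist : ∀ s t, dist (γ s) (γ t) ≤ dist (V s) (V t) := fun s t =>
    dist_le_dist_variationOnFromTo hloc (Set.mem_univ _) (Set.mem_univ _) (Set.mem_univ _)
  have hsurj : ∀ v : I, ∃ t, V t = V 1 * v := fun v => by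
    have hV1' : 0 ≤ V 1 := hV1 ▸ NNReal.coe_nonneg _
    obtain ⟨t, -, ht⟩ := intermediate_value_Icc zero_le_one
      (continuous_variationOnFromTo hloc γ.continuous 0).continuousOn
      (show V 1 * v ∈ Set.Icc (V 0) (V 1) from
        ⟨hV0 ▸ mul_nonneg hV1' v.2.1, mul_le_of_le_one_right hV1' v.2.2⟩)
    exact ⟨t, ht⟩
  choose τ hτ using hsurj
  have hlip : LipschitzWith (eVariationOn γ Set.univ).toNNReal fun v => γ (τ v) :=
    LipschitzWith.of_dist_le_mul fun v w => (hdist _ _).trans_eq <| by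
      rw [hτ, hτ, ← hV1, Real.dist_eq, ← mul_sub, abs_mul, Subtype.dist_eq, Real.dist_eq, hV1,
        NNReal.abs_eq]
  have hend : ∀ v, V (τ v) = V v → γ (τ v) = γ v := fun v hv =>
    dist_le_zero.1 ((hdist _ _).trans_eq (by rw [hv, dist_self]))
  exact ⟨⟨⟨_, hlip.continuous⟩, (hend 0 (by simp [hτ, hV0])).trans γ.source,
    (hend 1 (by simp [hτ])).trans γ.target⟩, hlip, Set.range_comp_subset_range τ γ⟩

theorem isCompact_setOf_lipschitzWith {Y : Type*} [MetricSpace Y] [ProperSpace Y] {M : Set Y}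
    (hM : IsClosed M) (x y : Y) (K : NNReal) :
    IsCompact {f : I → Y | LipschitzWith K f ∧ f 0 = x ∧ f 1 = y ∧ ∀ t, f t ∈ M} := by
  have hclosed : IsClosed {f : I → Y | ∀ t, f t ∈ M} := by
    rw [Set.ofPred_forall]
    exact isClosed_iInter fun t => hM.preimage (continuous_apply t)
  refine (isCompact_univ_pi fun _ : I => isCompact_closedBall x K).of_isClosed_subset ?_ ?_
  · exact (isClosed_setOfPred_lipschitzWith K).inter <|
      (isClosed_eq (continuous_apply 0) continuous_const).inter <|
      (isClosed_eq (continuous_apply 1) continuous_const).inter hclosed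
  · rintro f ⟨hf, rfl, -⟩ t -
    refine Metric.mem_closedBall.2
      ((hf.dist_le_mul t 0).trans (mul_le_of_le_one_right K.2 ?_))
    simpa only [Subtype.dist_eq, Real.dist_eq, Set.Icc.coe_zero, sub_zero, abs_of_nonneg t.2.1]
      using t.2.2

/-- The direct method: parametrized proportionally to length, the competitors that are at most as
long as `γ` form a compact set, on which the length is lower semicontinuous. -/
theorem exists_path_eVariationOn_le {Y : Type*} [MetricSpace Y] [ProperSpace Y] {M : Set Y}
    (hM : IsClosed M) {x y : Y} (γ : Path x y) (hγ : ∀ t, γ t ∈ M)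
    (hfin : eVariationOn γ Set.univ ≠ ⊤) :
    ∃ γ₀ : Path x y, (∀ t, γ₀ t ∈ M) ∧ ∀ δ : Path x y, (∀ t, δ t ∈ M) →
      eVariationOn γ₀ Set.univ ≤ eVariationOn δ Set.univ := by
  set K := (eVariationOn γ Set.univ).toNNReal
  have hK : K = eVariationOn γ Set.univ := ENNReal.coe_toNNReal hfin
  set S : Set (I → Y) := {f | LipschitzWith K f ∧ f 0 = x ∧ f 1 = y ∧ ∀ t, f t ∈ M}
  have hcompetitor : ∀ δ : Path x y, (∀ t, δ t ∈ M) → eVariationOn δ Set.univ ≤ K →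
      ∃ f ∈ S, eVariationOn f Set.univ ≤ eVariationOn δ Set.univ := fun δ hδ hδK => by
    have hδ' := ne_top_of_le_ne_top ENNReal.coe_ne_top hδK
    obtain ⟨f, hf, hfδ⟩ := exists_lipschitzWith_path_range_subset δ hδ'
    refine ⟨f, ⟨hf.weaken (ENNReal.toNNReal_mono hfin (hδK.trans hK.le)), f.source, f.target,
      fun t => ?_⟩,
      (eVariationOn_univ_le_of_lipschitzWith hf).trans_eq (ENNReal.coe_toNNReal hδ')⟩
    obtain ⟨u, hu⟩ := hfδ ⟨t, rfl⟩
    exact hu ▸ hδ u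
  have hlsc : LowerSemicontinuous fun f : I → Y => eVariationOn f Set.univ := fun f v hv =>
    eVariationOn.lowerSemicontinuous_aux (F := fun g : I → Y => g) (p := nhds f)
      (fun t _ => (continuous_apply t).tendsto f) hv
  obtain ⟨f₁, hf₁, hf₁K⟩ := hcompetitor γ hγ hK.ge
  obtain ⟨f, ⟨hf, hf0, hf1, hfM⟩, hmin⟩ := (hlsc.lowerSemicontinuousOn S).exists_isMinOn
    ⟨f₁, hf₁⟩ (isCompact_setOf_lipschitzWith hM x y K)
  refine ⟨⟨⟨f, hf.continuous⟩, hf0, hf1⟩, hfM, fun δ hδ => ?_⟩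
  rcases le_total (eVariationOn δ Set.univ) K with hδK | hδK
  · obtain ⟨g, hg, hgδ⟩ := hcompetitor δ hδ hδK
    exact (hmin hg).trans hgδ
  · exact (hmin hf₁).trans (hf₁K.trans (hK.ge.trans hδK))

theorem eVariationOn_subpath {Y : Type*} [PseudoEMetricSpace Y] {x y : Y} (γ : Path x y) {s t : I}
    (h : s ≤ t) : eVariationOn (γ.subpath s t) Set.univ = eVariationOn γ (Set.Icc s t) := by
  have hmono : Monotone (Set.Icc.convexComb s t) := fun a b hab => by
    rw [← Subtype.coe_le_coe] at h hab ⊢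
    simp only [Set.Icc.coe_convexComb]
    nlinarith
  have := eVariationOn.comp_eq_of_monotoneOn (γ : I → Y) (t := Set.univ)
    (Set.Icc.convexComb s t) (hmono.monotoneOn _)
  rwa [Set.image_univ, Path.range_subpathAux, Set.uIcc_of_le h] at this

theorem eVariationOn_subpath_add_eVariationOn_subpath {Y : Type*} [PseudoEMetricSpace Y] {x y : Y}
    (γ : Path x y) (t : I) :
    eVariationOn (γ.subpath 0 t) Set.univ + eVariationOn (γ.subpath t 1) Set.univ =
      eVariationOn γ Set.univ := by
  rw [eVariationOn_subpath γ (s := 0) t.2.1, eVariationOn_subpath γ (t := 1) t.2.2]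
  simpa only [Set.univ_inter, ← unitInterval.univ_eq_Icc] using
    eVariationOn.Icc_add_Icc γ (s := Set.univ) (a := 0) (b := t) (c := 1) t.2.1 t.2.2
      (Set.mem_univ _)

theorem exists_subpath_trans_eq {X : Type*} [TopologicalSpace X] {x y z : X} (γ : Path x y)
    (δ : Path y z) : ∃ (t : I) (h : γ.trans δ t = y),
      ((γ.trans δ).subpath 0 t).cast (γ.trans δ).source.symm h.symm = γ ∧
      ((γ.trans δ).subpath t 1).cast h.symm (γ.trans δ).target.symm = δ := by
  set t : I := ⟨1 / 2, by norm_num, by norm_num⟩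
  refine ⟨t, by simp [Path.trans_apply, t], ?_, ?_⟩
  · ext s
    have hs : ((Set.Icc.convexComb 0 t s : I) : ℝ) = s / 2 := by simp [t, div_eq_mul_inv]
    change γ.trans δ (Set.Icc.convexComb 0 t s) = γ s
    rw [← Path.extend_apply _ (Subtype.prop _), hs,
      Path.extend_trans_of_le_half _ _ (by linarith [s.2.2]), mul_div_cancel₀ _ two_ne_zero,
      Path.extend_apply]
  · ext s
    have hs : ((Set.Icc.convexComb t 1 s : I) : ℝ) = (1 + s) / 2 := by
      simp only [Set.Icc.coe_convexComb, t, Set.Icc.coe_one]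
      ring
    change γ.trans δ (Set.Icc.convexComb t 1 s) = δ s
    rw [← Path.extend_apply _ (Subtype.prop _), hs,
      Path.extend_trans_of_half_le _ _ (by linarith [s.2.1]), mul_div_cancel₀ _ two_ne_zero,
      add_sub_cancel_left, Path.extend_apply]

theorem eVariationOn_trans {Y : Type*} [PseudoEMetricSpace Y] {x y z : Y} (γ : Path x y)
    (δ : Path y z) : eVariationOn (γ.trans δ) Set.univ =
      eVariationOn γ Set.univ + eVariationOn δ Set.univ := by
  obtain ⟨t, h, hγ, hδ⟩ := exists_subpath_trans_eq γ δ
  calc eVariationOn (γ.trans δ) Set.univ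
      = eVariationOn (((γ.trans δ).subpath 0 t).cast (γ.trans δ).source.symm h.symm) Set.univ +
        eVariationOn (((γ.trans δ).subpath t 1).cast h.symm (γ.trans δ).target.symm) Set.univ :=
        (eVariationOn_subpath_add_eVariationOn_subpath _ t).symm
    _ = _ := by rw [hγ, hδ]

theorem edist_le_eVariationOn {Y : Type*} [PseudoEMetricSpace Y] {x y : Y} (γ : Path x y) :
    edist x y ≤ eVariationOn γ Set.univ := by
  simpa using eVariationOn.edist_le γ (Set.mem_univ 0) (Set.mem_univ 1)

theorem eVariationOn_segment {V : Type*} [SeminormedAddCommGroup V] [NormedSpace ℝ V] (x y : V) :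
    eVariationOn (Path.segment x y) Set.univ = edist x y := by
  refine le_antisymm ?_ (edist_le_eVariationOn _)
  rw [edist_nndist]
  have hlip : LipschitzWith (nndist x y * 1) (Path.segment x y) :=
    (lipschitzWith_lineMap (𝕜 := ℝ) x y).comp (LipschitzWith.subtype_val I)
  exact eVariationOn_univ_le_of_lipschitzWith (mul_one (nndist x y) ▸ hlip)

end PathLength

section SubpathHomotopy

variable {X : Type*} [TopologicalSpace X] {x y z : X}

theorem subpath_trans_subpath_homotopic (γ : Path x z) {t : I} (h : γ t = y) :
    (((γ.subpath 0 t).cast γ.source.symm h.symm).trans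
      ((γ.subpath t 1).cast h.symm γ.target.symm)).Homotopic γ := by
  subst h
  have hcast := Path.Homotopic.pathCast ⟨Path.Homotopy.subpathTransSubpath γ 0 t 1⟩
    γ.source.symm γ.target.symm
  rwa [γ.subpath_zero_one] at hcast

theorem homotopic_of_trans_homotopic_trans {γ γ' : Path x y} {δ δ' : Path y z}
    (h : (γ.trans δ).Homotopic (γ'.trans δ')) (hγ : γ.Homotopic γ') : δ.Homotopic δ' := by
  rw [← Path.Homotopic.Quotient.eq] at h hγ ⊢
  rw [Path.Homotopic.Quotient.mk_trans, Path.Homotopic.Quotient.mk_trans, ← hγ] at h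
  simpa only [← Path.Homotopic.Quotient.trans_assoc, Path.Homotopic.Quotient.symm_trans,
    Path.Homotopic.Quotient.refl_trans] using
    congrArg (Path.Homotopic.Quotient.mk γ).symm.trans h

theorem forall_trans_mem {M : Set X} {γ : Path x y} {δ : Path y z} (hγ : ∀ t, γ t ∈ M)
    (hδ : ∀ t, δ t ∈ M) (t : I) : γ.trans δ t ∈ M := by
  have hrange : Set.range (γ.trans δ) ⊆ M := by
    rw [Path.trans_range]
    exact Set.union_subset (Set.range_subset_iff.2 hγ) (Set.range_subset_iff.2 hδ)
  exact hrange ⟨t, rfl⟩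

/-- A path that stays in `M`, as a path in the subspace `M`. It turns homotopies inside `M` into
homotopies of paths in a space. -/
def pathCodRestrict {M : Set X} (γ : Path x y) (hγ : ∀ t, γ t ∈ M) (hx : x ∈ M) (hy : y ∈ M) :
    Path (⟨x, hx⟩ : M) ⟨y, hy⟩ where
  toFun t := ⟨γ t, hγ t⟩
  source' := Subtype.ext γ.source
  target' := Subtype.ext γ.target

end SubpathHomotopy

section HomotopicIn

variable {M : Set Plane} {x y z : Plane}

theorem homotopicIn_iff_homotopic_pathCodRestrict {γ δ : Path x y} (hγ : ∀ t, γ t ∈ M)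
    (hδ : ∀ t, δ t ∈ M) (hx : x ∈ M) (hy : y ∈ M) :
    HomotopicIn M γ δ ↔
      (pathCodRestrict γ hγ hx hy).Homotopic (pathCodRestrict δ hδ hx hy) := by
  constructor
  · rintro ⟨F, hF⟩
    exact ⟨{ toFun := fun w => ⟨F w, hF w⟩
             map_zero_left := fun t => Subtype.ext (F.apply_zero t)
             map_one_left := fun t => Subtype.ext (F.apply_one t)
             prop' := fun t s hs => Subtype.ext (F.prop' t s hs) }⟩
  · rintro ⟨F⟩
    exact ⟨{ toFun := fun w => F w
             map_zero_left := fun t => congrArg Subtype.val (F.apply_zero t)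
             map_one_left := fun t => congrArg Subtype.val (F.apply_one t)
             prop' := fun t s hs => congrArg Subtype.val (F.prop' t s hs) }, fun w => (F w).2⟩

namespace HomotopicIn

theorem refl {γ : Path x y} (h : ∀ t, γ t ∈ M) : HomotopicIn M γ γ :=
  ⟨Path.Homotopy.refl γ, fun w => h w.2⟩

theorem mem_left {γ δ : Path x y} (h : HomotopicIn M γ δ) (t : I) : γ t ∈ M := by
  obtain ⟨F, hF⟩ := h
  exact F.apply_zero t ▸ hF (0, t)

theorem mem_right {γ δ : Path x y} (h : HomotopicIn M γ δ) (t : I) : δ t ∈ M := by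
  obtain ⟨F, hF⟩ := h
  exact F.apply_one t ▸ hF (1, t)

theorem subpath_of_trans {γ : Path x z} {a : Path x y} {b : Path y z} {t : I} (h : γ t = y)
    (hγ : HomotopicIn M γ (a.trans b))
    (ha : HomotopicIn M ((γ.subpath 0 t).cast γ.source.symm h.symm) a) :
    HomotopicIn M ((γ.subpath t 1).cast h.symm γ.target.symm) b := by
  have hx : x ∈ M := γ.source ▸ hγ.mem_left 0
  have hy : y ∈ M := h ▸ hγ.mem_left t
  have hz : z ∈ M := γ.target ▸ hγ.mem_left 1
  have hb : ∀ s, b s ∈ M := Set.range_subset_iff.1 <|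
    (Set.subset_union_right.trans_eq (Path.trans_range a b).symm).trans
      (Set.range_subset_iff.2 hγ.mem_right)
  let γM := pathCodRestrict γ hγ.mem_left hx hz
  have ht : γM t = ⟨y, hy⟩ := Subtype.ext h
  have htrans : pathCodRestrict (a.trans b) hγ.mem_right hx hz =
      (pathCodRestrict a ha.mem_right hx hy).trans (pathCodRestrict b hb hy hz) := by
    ext s
    simp only [pathCodRestrict, Path.trans_apply, Path.coe_mk_mk]
    split_ifs <;> rfl
  have hhom := (subpath_trans_subpath_homotopic γM ht).trans
    (htrans ▸ (homotopicIn_iff_homotopic_pathCodRestrict _ _ hx hz).1 hγ)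
  exact (homotopicIn_iff_homotopic_pathCodRestrict
    (γ := (γ.subpath t 1).cast h.symm γ.target.symm) (fun _ => hγ.mem_left _) hb hy hz).2
    (homotopic_of_trans_homotopic_trans hhom
      ((homotopicIn_iff_homotopic_pathCodRestrict _ _ hx hy).1 ha))

end HomotopicIn

end HomotopicIn

section Tree

theorem pathLength_trans {x y z : Plane} (γ : Path x y) (δ : Path y z) :
    pathLength (γ.trans δ) = pathLength γ + pathLength δ :=
  eVariationOn_trans γ δ

theorem exists_path_pathLength_eq_edist {M : Set Plane} {x y : Plane} (h : segment ℝ x y ⊆ M) :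
    ∃ ν : Path x y, (∀ t, ν t ∈ M) ∧ pathLength ν = edist x y :=
  ⟨Path.segment x y, Set.range_subset_iff.1 ((Path.range_segment x y).trans_subset h),
    eVariationOn_segment x y⟩

namespace Environment

variable {E : Environment} {s p : Plane}

theorem Gap.segment_crit_subset_free (G : E.Gap p) {m : Plane} (hm : m ∈ G.sweeper) :
    segment ℝ G.crit m ⊆ E.free := by
  obtain ⟨φ, hφ, rfl, hfree⟩ := hm
  rw [segment_eq_image_lineMap]
  rintro _ ⟨t, ht, rfl⟩
  have hline : AffineMap.lineMap G.crit (p + φ • G.a + E.R • G.b) t =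
      p + (G.near + t * (φ - G.near)) • G.a + E.R • G.b := by
    rw [AffineMap.lineMap_apply_module, Gap.crit]
    module
  rw [hline]
  refine hfree _ ⟨?_, ?_⟩ <;> nlinarith [hφ.1, ht.1, ht.2]

theorem Corridor.exists_split_edge (C : E.Corridor p) {q : Plane} {t : I} (hq : C.edge t = q) :
    ∃ (α : Path p q) (β : Path q C.crit), (∀ u, α u ∈ E.free) ∧ (∀ u, β u ∈ E.free) ∧
      pathLength α = pathLengthUpTo C.edge t ∧
      pathLengthUpTo C.edge t + pathLength β = pathLength C.edge := by
  have hα : pathLength (C.edge.subpath 0 t) = pathLengthUpTo C.edge t := by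
    rw [pathLength, eVariationOn_subpath _ (s := 0) t.2.1, pathLengthUpTo]
    congr 1
    exact Set.Icc_bot
  exact ⟨(C.edge.subpath 0 t).cast C.edge.source.symm hq.symm,
    (C.edge.subpath t 1).cast hq.symm C.edge.target.symm, fun _ => (C.edge_mem _).1,
    fun _ => (C.edge_mem _).1, hα,
    hα ▸ eVariationOn_subpath_add_eVariationOn_subpath C.edge t⟩

namespace Node

theorem g_root : (root : Node E s s).g = 0 :=
  eVariationOn.constant_on (by rintro _ ⟨a, -, rfl⟩ _ ⟨b, -, rfl⟩; rfl)

theorem g_child (n : Node E s p) (C : E.Corridor p) :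
    (n.child C).g = n.g + pathLength C.edge :=
  pathLength_trans _ _

theorem mem_free_of_mem_paths : ∀ {p : Plane} (n : Node E s p) {x : Plane} {γ : Path s x},
    γ ∈ n.paths x → ∀ t, γ t ∈ E.free
  | _, root, _, _, h => h
  | _, child _ _, _, _, h => h.1

theorem treePath_trans_mem_paths : ∀ {p : Plane} (n : Node E s p) {x : Plane} (δ : Path p x),
    (∀ t, δ t ∈ E.free) → n.treePath.trans δ ∈ n.paths x
  | _, root, _, δ, hδ => forall_trans_mem (fun _ => δ.source ▸ hδ 0) hδ
  | _, child n C, _, δ, hδ => by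
    have htree := n.treePath_trans_mem_paths C.edge fun t => (C.edge_mem t).1
    have hfree := n.mem_free_of_mem_paths htree
    obtain ⟨t, ht, hprefix, -⟩ := exists_subpath_trans_eq (n.child C).treePath δ
    refine ⟨forall_trans_mem hfree hδ, t, ht, ?_, ?_⟩
    · exact hprefix.symm ▸ HomotopicIn.refl hfree
    · exact hprefix.symm ▸ htree

/-- The inequality goes up the tree by induction: up to homotopy, the part of the path after the
visit of the parent is the edge, which is shortest in its homotopy class. -/
theorem exists_g_le_pathLength_subpath : ∀ {p : Plane} (n : Node E s p) {x : Plane} {γ : Path s x},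
    γ ∈ n.paths x → ∃ (t : I) (h : γ t = p),
      HomotopicIn E.free ((γ.subpath 0 t).cast γ.source.symm h.symm) n.treePath ∧
      n.g ≤ pathLength (γ.subpath 0 t)
  | _, root, _, γ, hγ => by
    have hrefl : (γ.subpath 0 0).cast γ.source.symm γ.source.symm = Path.refl s := by
      ext t
      simp
    exact ⟨0, γ.source, hrefl ▸ HomotopicIn.refl fun _ => γ.source ▸ hγ 0,
      g_root (E := E) (s := s) ▸ zero_le⟩
  | _, child n C, _, γ, hγ => by
    obtain ⟨-, t, h, hhom, hmem⟩ := hγ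
    obtain ⟨t', h', hhom', hle⟩ := n.exists_g_le_pathLength_subpath hmem
    have hedge := C.pathLength_edge_le (HomotopicIn.subpath_of_trans h' hhom hhom')
    refine ⟨t, h, hhom, ?_⟩
    rw [g_child]
    exact (add_le_add hle hedge).trans_eq (eVariationOn_subpath_add_eVariationOn_subpath
      ((γ.subpath 0 t).cast γ.source.symm h.symm) t')

theorem exists_isLeast (n : Node E s p) {x : Plane} (δ : Path p x) (hδ : ∀ t, δ t ∈ E.free)
    (hfin : pathLength δ ≠ ⊤) : ∃ δ₀ : Path p x, pathLength δ₀ ≤ pathLength δ ∧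
      IsLeast (pathLength '' n.paths x) (n.g + pathLength δ₀) := by
  obtain ⟨δ₀, hδ₀, hmin⟩ := exists_path_eVariationOn_le isClosed_free δ hδ hfin
  refine ⟨δ₀, hmin δ hδ, ⟨_, n.treePath_trans_mem_paths δ₀ hδ₀, pathLength_trans _ _⟩, ?_⟩
  rintro _ ⟨γ, hγ, rfl⟩
  obtain ⟨t, h, -, hle⟩ := n.exists_g_le_pathLength_subpath hγ
  have hrest := hmin ((γ.subpath t 1).cast h.symm γ.target.symm) fun _ =>
    n.mem_free_of_mem_paths hγ _
  exact (add_le_add hle hrest).trans_eq (eVariationOn_subpath_add_eVariationOn_subpath γ t)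

theorem beats_child_of_lt {p' : Plane} (n : Node E s p) (n' : Node E s p') (C : E.Corridor p')
    (δ : Path p C.crit) (hδ : ∀ t, δ t ∈ E.free) (hlt : n.g + pathLength δ < (n'.child C).g)
    {m : Plane} (hm : m ∈ C.sweeper) : n.Beats (n'.child C) m := by
  obtain ⟨ν, hν, hνlen⟩ := exists_path_pathLength_eq_edist (C.segment_crit_subset_free hm)
  have hνfin : pathLength ν ≠ ⊤ := hνlen ▸ edist_ne_top _ _
  have hδfin : pathLength δ ≠ ⊤ := ne_top_of_le_ne_top hlt.ne_top le_add_self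
  obtain ⟨δ₀, hδ₀, hleast⟩ := n.exists_isLeast (δ.trans ν) (forall_trans_mem hδ hν)
    (pathLength_trans δ ν ▸ ENNReal.add_ne_top.2 ⟨hδfin, hνfin⟩)
  obtain ⟨ν₀, -, hleast'⟩ := (n'.child C).exists_isLeast ν hν hνfin
  refine ⟨_, _, hleast, hleast', ?_⟩
  calc n.g + pathLength δ₀ ≤ n.g + pathLength (δ.trans ν) := by gcongr
    _ = n.g + pathLength δ + pathLength ν := by rw [pathLength_trans, add_assoc]
    _ < (n'.child C).g + pathLength ν := ENNReal.add_lt_add_right hνfin hlt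
    _ ≤ (n'.child C).g + pathLength ν₀ := by
      gcongr
      exact hνlen.trans_le (edist_le_eVariationOn ν₀)

end Node

end Environment

end Tree

theorem mainTheorem10 (E : Environment) (pStart : Plane) {p_i p_j : Plane}
    (i : E.Node pStart p_i) (j : E.Node pStart p_j)
    (k : E.Corridor p_i) (l : E.Corridor p_j)
    (q : Plane) (hqs : q ∈ l.sweeper) (t : unitInterval) (hqt : k.edge t = q) :
    ((j.child l).g + edist l.crit q < i.g + pathLengthUpTo k.edge t →
      ∀ m ∈ k.sweeper, (j.child l).Beats (i.child k) m) ∧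
    (i.g + pathLengthUpTo k.edge t + edist q l.crit < (j.child l).g →
      ∀ m ∈ l.sweeper, i.Beats (j.child l) m) := by
  obtain ⟨α, β, hα, hβ, hαlen, hαβ⟩ := k.exists_split_edge hqt
  have hβfin : pathLength β ≠ ⊤ := ne_top_of_le_ne_top k.edge_finite (hαβ ▸ le_add_self)
  constructor
  · intro hlt m hm
    obtain ⟨ν, hν, hνlen⟩ := exists_path_pathLength_eq_edist (l.segment_crit_subset_free hqs)
    refine (j.child l).beats_child_of_lt i k (ν.trans β) (forall_trans_mem hν hβ) ?_ hm
    calc (j.child l).g + pathLength (ν.trans β)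
        = (j.child l).g + edist l.crit q + pathLength β := by
          rw [pathLength_trans, hνlen, add_assoc]
      _ < i.g + pathLengthUpTo k.edge t + pathLength β := ENNReal.add_lt_add_right hβfin hlt
      _ = (i.child k).g := by rw [i.g_child, ← hαβ, add_assoc]
  · intro hlt m hm
    obtain ⟨ν, hν, hνlen⟩ := exists_path_pathLength_eq_edist
      (segment_symm ℝ l.crit q ▸ l.segment_crit_subset_free hqs)
    refine i.beats_child_of_lt j l (α.trans ν) (forall_trans_mem hα hν) ?_ hm
    rwa [pathLength_trans, hαlen, hνlen, ← add_assoc]
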